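/- Let $X$ be a compact Hausdorff space and let $A=C(X)$ be the commutative $C^*$-algebra of continuous complex-valued functions on $X$ with the supremum norm. Let $l_2(A)$ be the standard Hilbert $A$-module, i.e. the set of all sequences $(a_1,a_2,\dots)$ in $A$ for which the series $\sum_{i=1}^\infty a_i^*a_i$ converges in norm, with coordinatewise operations, inner product $\langle a,b\rangle=\sum_i a_i^*b_i$ and norm $\|a\|=\|\sum_i a_i^*a_i\|^{1/2}$. For a Banach $A$-module $M$ let $M'$ be the Banach $A$-module of all bounded $A$-linear maps $M\to A$ (with the operator norm), and let $M''=(M')'$. A Hilbert $A$-module $M$ is called $C^*$-reflexive if $M''=M$, that is, if the canonical map $M\to M''$, $m\mapsto\dot m$, $\dot m(f)=f(m)$ for $f\in M'$, is an isometry of $M$ onto $M''$. **Theorem.** Suppose that $X$ does not contain a copy of the Stone–Čech compactification $\beta\mathbb N$ of the discrete space $\mathbb N$ as a closed subset, i.e. there is no homeomorphism of $\beta\mathbb N$ onto a closed subset of $X$. Then the Hilbert $C(X)$-module $l_2(C(X))$ is $C^*$-reflexive. -/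

import Mathlib

noncomputable section

/-! ### Banach modules over a commutative C*-algebra: duals, biduals, C*-reflexivity -/

section Dual

variable (A : Type*) [CommCStarAlgebra A]
variable (E : Type*) [NormedAddCommGroup E] [NormedSpace ℂ E] [Module A E]

/-- The dual module `E'`: all bounded `A`-linear maps `E → A`, with the operator norm and the
pointwise `A`-module structure `(a • f) x = a * f x`. (As `A` is unital, an `A`-linear map between
compatible modules is automatically `ℂ`-linear.) -/
def moduleDual : Submodule A (E →L[ℂ] A) where
  carrier := {f | ∀ (a : A) (x : E), f (a • x) = a * f x}
  add_mem' := by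
    intro f g hf hg a x
    simp only [add_apply, hf a x, hg a x, mul_add]
  zero_mem' := by
    intro a x
    simp
  smul_mem' := by
    intro c f hf a x
    simp only [smul_apply, hf a x, smul_eq_mul]
    ring

variable {E}

/-- The canonical map `E → E''` into the second dual module: `m ↦ (f ↦ f m)`. -/
def bidualMap (m : E) : moduleDual A (moduleDual A E) :=
  ⟨LinearMap.mkContinuous
    { toFun := fun f => f.1 m
      map_add' := fun _ _ => rfl
      map_smul' := fun _ _ => rfl } ‖m‖
    (fun f => by
      rw [mul_comm]
      exact f.1.le_opNorm m), fun _ _ => rfl⟩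

@[simp]
theorem bidualMap_apply (m : E) (f : moduleDual A E) : (bidualMap A m).1 f = f.1 m := rfl

variable (E)

/-- `E` is C*-reflexive, `E'' = E`: the canonical map `E → E''` is an isometry onto `E''`. -/
def IsCStarReflexive : Prop :=
  Isometry (bidualMap A : E → moduleDual A (moduleDual A E)) ∧
    Function.Surjective (bidualMap A : E → moduleDual A (moduleDual A E))

end Dual

/-! ### The standard Hilbert C*-module `l₂(A)` -/

section L2

variable {A : Type*} [CommCStarAlgebra A]

theorem summable_of_nonneg_of_le_cstar [PartialOrder A] [StarOrderedRing A] {f g : ℕ → A}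
    (hf : ∀ i, 0 ≤ f i) (hfg : ∀ i, f i ≤ g i) (hg : Summable g) : Summable f := by
  rw [summable_iff_vanishing_norm] at hg ⊢
  intro ε hε
  obtain ⟨s, hs⟩ := hg ε hε
  refine ⟨s, fun t ht => lt_of_le_of_lt ?_ (hs t ht)⟩
  exact CStarAlgebra.norm_le_norm_of_nonneg_of_le (Finset.sum_nonneg fun i _ => hf i)
    (Finset.sum_le_sum fun i _ => hfg i)

theorem summable_star_mul_self_add {a b : ℕ → A} (ha : Summable fun i => star (a i) * a i)
    (hb : Summable fun i => star (b i) * b i) :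
    Summable fun i => star (a i + b i) * (a i + b i) := by
  let _ := CStarAlgebra.spectralOrder A
  let _ := CStarAlgebra.spectralOrderedRing A
  have h := (ha.add hb).add (ha.add hb)
  refine summable_of_nonneg_of_le_cstar (fun i => star_mul_self_nonneg _) (fun i => ?_) h
  rw [← sub_nonneg]
  have h0 : 0 ≤ star (a i - b i) * (a i - b i) := star_mul_self_nonneg _
  convert h0 using 1
  simp only [star_add, star_sub]
  ring

theorem summable_star_mul_of_summable {a b : ℕ → A} (ha : Summable fun i => star (a i) * a i)
    (hb : Summable fun i => star (b i) * b i) : Summable fun i => star (a i) * b i := by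
  have hb' : Summable fun i => star (Complex.I • b i) * (Complex.I • b i) := by
    refine hb.congr fun i => ?_
    rw [star_smul, smul_mul_smul_comm]
    simp
  have h1 := ((summable_star_mul_self_add ha hb).sub (ha.add hb))
  have h2 := ((summable_star_mul_self_add ha hb').sub (ha.add hb')).const_smul Complex.I
  refine ((h1.sub h2).const_smul (1 / 2 : ℂ)).congr fun i => ?_
  simp only [star_add, star_smul, add_mul, mul_add, smul_mul_assoc, mul_smul_comm]
  simp only [Complex.star_def, Complex.conj_I]
  match_scalars <;> ring_nf <;> simp <;> norm_num

variable (A)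

/-- The sequences `(a₁, a₂, …)` in `A` for which `∑ aᵢ* aᵢ` converges in norm. The terms are
positive, so that convergence of the partial sums and unconditional convergence agree, see
`mem_l2Submodule_iff`. -/
def l2Submodule : Submodule A (ℕ → A) where
  carrier := {a | Summable fun i => star (a i) * a i}
  add_mem' := fun ha hb => summable_star_mul_self_add ha hb
  zero_mem' := by
    simp only [Set.mem_ofPred_eq, Pi.zero_apply, mul_zero]
    exact summable_zero
  smul_mem' := by
    intro c a ha
    refine (Summable.mul_left (star c * c) ha).congr fun i => ?_
    simp only [Pi.smul_apply, smul_eq_mul, star_mul]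
    ring

theorem mem_l2Submodule_iff (a : ℕ → A) : a ∈ l2Submodule A ↔
    ∃ s : A, Filter.Tendsto (fun N => ∑ i ∈ Finset.range N, star (a i) * a i)
      Filter.atTop (nhds s) := by
  let _ := CStarAlgebra.spectralOrder A
  let _ := CStarAlgebra.spectralOrderedRing A
  refine ⟨fun h => ⟨_, (show Summable fun i => star (a i) * a i from h).hasSum.tendsto_sum_nat⟩,
    fun ⟨s, hs⟩ => ?_⟩
  change Summable fun i => star (a i) * a i
  rw [summable_iff_vanishing_norm]
  intro ε hε
  obtain ⟨N, hN⟩ := Metric.cauchySeq_iff'.1 hs.cauchySeq ε hε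
  refine ⟨Finset.range N, fun t ht => ?_⟩
  obtain ⟨n, hn⟩ := t.exists_nat_subset_range
  have hsub : t ⊆ Finset.range (max n N) \ Finset.range N := by
    intro i hi
    rw [Finset.mem_sdiff]
    exact ⟨Finset.range_mono (le_max_left n N) (hn hi), Finset.disjoint_left.1 ht hi⟩
  have h1 : ∑ i ∈ t, star (a i) * a i ≤
      ∑ i ∈ Finset.range (max n N) \ Finset.range N, star (a i) * a i :=
    Finset.sum_le_sum_of_subset_of_nonneg hsub fun i _ _ => star_mul_self_nonneg _
  have h2 := hN (max n N) (le_max_right n N)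
  rw [dist_eq_norm, ← Finset.sum_sdiff_eq_sub (Finset.range_mono (le_max_right n N))] at h2
  exact lt_of_le_of_lt (CStarAlgebra.norm_le_norm_of_nonneg_of_le
    (Finset.sum_nonneg fun i _ => star_mul_self_nonneg _) h1) h2

/-- The standard Hilbert module `l₂(A)`. -/
def L2 : Type _ := l2Submodule A

namespace L2

instance : AddCommGroup (L2 A) := inferInstanceAs (AddCommGroup (l2Submodule A))
instance : Module A (L2 A) := inferInstanceAs (Module A (l2Submodule A))
instance : Module ℂ (L2 A) := inferInstanceAs (Module ℂ (l2Submodule A))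
instance : IsScalarTower ℂ A (L2 A) := inferInstanceAs (IsScalarTower ℂ A (l2Submodule A))

/-- `⟨x, y⟩ = ∑ xᵢ* yᵢ`. -/
instance : Inner A (L2 A) := ⟨fun x y => ∑' i, star (x.1 i) * y.1 i⟩

/-- `‖x‖ = ‖∑ xᵢ* xᵢ‖ ^ (1/2)`. -/
instance : Norm (L2 A) := ⟨fun x => √‖∑' i, star (x.1 i) * x.1 i‖⟩

variable {A}

theorem summable_inner (x y : L2 A) : Summable fun i => star (x.1 i) * y.1 i :=
  summable_star_mul_of_summable x.2 y.2

instance [PartialOrder A] [StarOrderedRing A] : CStarModule A (L2 A) where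
  inner_add_right {x y z} := by
    change ∑' i, star (x.1 i) * (y.1 i + z.1 i) = _
    simp only [mul_add]
    exact (summable_inner x y).tsum_add (summable_inner x z)
  inner_self_nonneg {x} := tsum_nonneg fun i => star_mul_self_nonneg (x.1 i)
  inner_self {x} := by
    constructor
    · intro h
      have h0 := (summable_inner x x).hasSum
      rw [show ∑' i, star (x.1 i) * x.1 i = 0 from h,
        hasSum_zero_iff_of_nonneg fun i => star_mul_self_nonneg (x.1 i)] at h0
      refine Subtype.ext (funext fun i => ?_)
      exact (CStarRing.star_mul_self_eq_zero_iff _).1 (congrFun h0 i)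
    · rintro rfl
      change ∑' i, star (0 : A) * (0 : A) = 0
      simp
  inner_op_smul_right {a x y} := by
    change ∑' i, star (x.1 i) * (a * y.1 i) = a * ∑' i, star (x.1 i) * y.1 i
    rw [← (summable_inner x y).tsum_mul_left]
    exact tsum_congr fun i => by ring
  inner_smul_right_complex {z x y} := by
    change ∑' i, star (x.1 i) * (z • y.1 i) = z • ∑' i, star (x.1 i) * y.1 i
    rw [← (summable_inner x y).tsum_const_smul]
    exact tsum_congr fun i => by rw [mul_smul_comm]
  star_inner x y := by
    change star (∑' i, star (x.1 i) * y.1 i) = ∑' i, star (y.1 i) * x.1 i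
    rw [tsum_star]
    exact tsum_congr fun i => by rw [star_mul, star_star]
  norm_eq_sqrt_norm_inner_self x := rfl

theorem normCore : NormedSpace.Core ℂ (L2 A) :=
  letI := CStarAlgebra.spectralOrder A
  letI := CStarAlgebra.spectralOrderedRing A
  CStarModule.normedSpaceCore A

instance : NormedAddCommGroup (L2 A) := NormedAddCommGroup.ofCore normCore

instance : NormedSpace ℂ (L2 A) := NormedSpace.ofCore normCore

end L2

end L2

end

/-!
Let `eᵢ*` denote the `i`-th coordinate functional on `l₂(C(X))`. A bounded functional `f` is
determined by its coordinates `fᵢ = f(eᵢ)`, and a sequence `w` in `C(X)` is the coordinate sequence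
of a functional of norm at most `B` exactly when all finite sums `∑ |wᵢ|²` are bounded by `B²`
(`L2.ofCoeff`, `L2.sum_norm_sq_functional_le`). So the dual differs from `l₂(C(X))` in that
`∑ |wᵢ|²` need not converge in norm. The canonical map into the bidual is isometric because the
functional `⟨m, ·⟩` of norm at most `‖m‖` takes a value of norm `‖m‖²` at `m`.

For surjectivity let `F` be an element of the bidual and put `gᵢ = F(eᵢ*)`. Testing `F` on
`∑ gᵢ* eᵢ*` shows that the finite sums `∑ |gᵢ|²` are bounded. Two facts complete the proof.

* `F` is determined by `g`, for any compact Hausdorff `X` (`L2.bidual_apply_eq_zero_of_coord`).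
  For a functional `f` the sum `∑ |fᵢ|²` converges pointwise, so that by the Baire category theorem
  its tails are uniformly small on open sets with dense union. After multiplication by a bump
  function, `f` is there close in norm to a finite combination of the `eᵢ*`.

* `∑ |gᵢ|²` converges in norm (`L2.summable_bidual_coord`); here the hypothesis on `X` is used.
  Otherwise there are disjoint blocks of indices and points `y k` such that the `k`-th block of
  `∑ |gᵢ|²` is bounded below at `y k`. By boundedness of the sum every point occurs only finitely
  often, so after passing to a subsequence the `y k` lie in disjoint open sets `U k`. Cutting the
  `k`-th block of `g*` off to `U k` and weighting the blocks with bounded scalars gives a functional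
  whose image under `F` is a continuous function on `X` with prescribed bounded values at the
  `y k`. Hence bounded functions on `{y k}` extend continuously to `X`, and the closure of `{y k}`
  is a copy of `βℕ`.
-/

/-! ### Sequences in compact Hausdorff spaces -/

section Topology

variable {X : Type*} [TopologicalSpace X] [CompactSpace X] [T2Space X]

theorem exists_bump {U : Set X} (hU : IsOpen U) {y : X} (hy : y ∈ U) :
    ∃ φ : C(X, ℂ), φ y = 1 ∧ (∀ x, x ∉ U → φ x = 0) ∧ ∀ x, ‖φ x‖ ≤ 1 := by
  obtain ⟨f, hf0, hf1, hf⟩ := exists_continuous_zero_one_of_isClosed hU.isClosed_compl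
    (isClosed_singleton (x := y)) (Set.disjoint_singleton_right.2 fun h => h hy)
  refine ⟨⟨fun x => (f x : ℂ), Complex.continuous_ofReal.comp f.continuous⟩, ?_, ?_, ?_⟩
  · simpa using hf1 rfl
  · intro x hx
    simpa using hf0 hx
  · intro x
    have h := hf x
    simpa [abs_of_nonneg h.1] using h.2

/-- A sequence with finite fibres has a subsequence whose terms lie in pairwise disjoint open
sets. -/
theorem exists_subseq_mem_pairwise_disjoint_isOpen {x : ℕ → X}
    (hx : ∀ p, {k | x k = p}.Finite) :
    ∃ (σ : ℕ → ℕ) (U : ℕ → Set X), Function.Injective σ ∧ (∀ k, IsOpen (U k)) ∧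
      Pairwise (Function.onFun Disjoint U) ∧ ∀ k, x (σ k) ∈ U k := by
  have hinf : Infinite (Set.range x) := by
    by_contra h
    rw [not_infinite_iff_finite] at h
    obtain ⟨p, hp⟩ := Finite.exists_infinite_fiber (Set.rangeFactorization x)
    have := Set.infinite_coe_iff.1 hp
    refine this ((hx p.1).subset fun k hk => ?_)
    exact congrArg Subtype.val hk
  obtain ⟨e, he⟩ := exists_topology_isEmbedding_nat (Set.range x)
  have hg := Topology.IsEmbedding.subtypeVal.comp he
  have hσ : ∀ k, ∃ j, x j = (e k).1 := fun k => (e k).2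
  choose σ hσ using hσ
  -- Closed neighbourhoods `K k` that contain one term each; removing the earlier ones from the
  -- interior of each makes them disjoint.
  have hV : ∀ k, ∃ K : Set X, IsClosed K ∧ (e k).1 ∈ interior K ∧ ∀ j, (e j).1 ∈ K → j = k := by
    intro k
    obtain ⟨V, hVo, hV⟩ := hg.isInducing.isOpen_iff.1 (isOpen_discrete {k})
    have hkV : (e k).1 ∈ V := by
      have : k ∈ (Subtype.val ∘ e) ⁻¹' V := by rw [hV]; rfl
      exact this
    obtain ⟨K, hK, hKc, hKV⟩ := exists_mem_nhds_isClosed_subset (hVo.mem_nhds hkV)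
    refine ⟨K, hKc, mem_interior_iff_mem_nhds.2 hK, fun j hj => ?_⟩
    have : j ∈ (Subtype.val ∘ e) ⁻¹' V := hKV hj
    rwa [hV] at this
  choose K hKc hKi hK using hV
  refine ⟨σ, fun k => interior (K k) \ ⋃ j ∈ Finset.range k, K j, ?_, ?_, ?_, ?_⟩
  · intro a b hab
    apply he.injective
    apply Subtype.ext
    rw [← hσ, ← hσ, hab]
  · exact fun k => isOpen_interior.sdiff (isClosed_biUnion_finset fun j _ => hKc j)
  · have key : ∀ a b : ℕ, a < b → Disjoint (interior (K a) \ ⋃ j ∈ Finset.range a, K j)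
        (interior (K b) \ ⋃ j ∈ Finset.range b, K j) := by
      intro a b hab
      rw [Set.disjoint_left]
      intro p hp hp'
      exact hp'.2 (Set.mem_biUnion (Finset.mem_coe.2 (Finset.mem_range.2 hab))
        (interior_subset hp.1))
    intro a b hab
    rcases lt_or_gt_of_ne hab with h | h
    · exact key a b h
    · exact (key b a h).symm
  · intro k
    dsimp only
    rw [hσ]
    refine ⟨hKi k, fun h => ?_⟩
    simp only [Set.mem_iUnion, Finset.mem_range] at h
    obtain ⟨j, hj, h⟩ := h
    exact hj.ne (hK j k h).symm

/-- If every bounded scalar function on the terms of a sequence extends continuously to the whole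
space, then the closure of the sequence is a copy of `βℕ`. -/
theorem exists_isClosedEmbedding_stoneCech_of_interpolation (y : ℕ → X)
    (h : ∀ (c : ℕ → ℂ) (B : ℝ), (∀ k, ‖c k‖ ≤ B) → ∃ G : C(X, ℂ), ∀ k, G (y k) = c k) :
    ∃ f : StoneCech ℕ → X, Topology.IsClosedEmbedding f := by
  have hy : Continuous y := continuous_of_discreteTopology
  refine ⟨stoneCechExtend hy, (continuous_stoneCechExtend hy).isClosedEmbedding fun p q hpq => ?_⟩
  by_contra hne
  -- An extension to `X` of a function on `βℕ` that separates `p` and `q` shows that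
  -- these points have different images.
  obtain ⟨φ, hp, hq, hφ⟩ := exists_bump (isOpen_compl_singleton (x := q)) (y := p) hne
  obtain ⟨G, hG⟩ := h (fun k => φ (stoneCechUnit k)) 1 fun k => hφ _
  have heq : (fun z => G (stoneCechExtend hy z)) = φ := by
    refine stoneCech_hom_ext (G.continuous.comp (continuous_stoneCechExtend hy)) φ.continuous ?_
    funext k
    simpa using hG k
  have h1 := congrFun heq p
  have h2 := congrFun heq q
  rw [hpq, h2, hp, hq q (fun h => h rfl)] at h1
  exact zero_ne_one h1

end Topology

noncomputable section

/-! ### Operator norms on dual modules -/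

section Dual

variable {A : Type*} [CommCStarAlgebra A]
variable {E : Type*} [NormedAddCommGroup E] [NormedSpace ℂ E] [Module A E]

-- Direct instances keep the search short for the bidual, which is the case `E = moduleDual A _`.
instance moduleDual.normedAddCommGroup : NormedAddCommGroup (moduleDual A E) := inferInstance

instance moduleDual.normedSpace : NormedSpace ℂ (moduleDual A E) := inferInstance

theorem moduleDual.norm_apply_le (f : moduleDual A E) (x : E) : ‖f.1 x‖ ≤ ‖f‖ * ‖x‖ :=
  f.1.le_opNorm x

theorem moduleDual.norm_le_of_bound (f : moduleDual A E) {B : ℝ} (hB : 0 ≤ B)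
    (h : ∀ x, ‖f.1 x‖ ≤ B * ‖x‖) : ‖f‖ ≤ B :=
  f.1.opNorm_le_bound hB h

theorem norm_bidualMap_le (m : E) : ‖bidualMap A m‖ ≤ ‖m‖ :=
  moduleDual.norm_le_of_bound _ (norm_nonneg m) fun f => by
    rw [mul_comm]
    exact moduleDual.norm_apply_le f m

theorem bidualMap_sub (m n : E) : bidualMap A m - bidualMap A n = bidualMap A (m - n) :=
  Subtype.ext (ContinuousLinearMap.ext fun f => (map_sub f.1 m n).symm)

/-- The canonical map preserves the norm of `m` if some functional of norm at most `‖m‖` takes a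
value of norm `‖m‖²` at `m`. -/
theorem norm_bidualMap_eq_of_norming {m : E} {f : moduleDual A E} (hf : ‖f‖ ≤ ‖m‖)
    (hfm : ‖f.1 m‖ = ‖m‖ ^ 2) : ‖bidualMap A m‖ = ‖m‖ := by
  refine le_antisymm (norm_bidualMap_le m) ?_
  have h1 := moduleDual.norm_apply_le (bidualMap A m) f
  rw [bidualMap_apply, hfm] at h1
  have h3 := h1.trans (mul_le_mul_of_nonneg_left hf (norm_nonneg _))
  rcases (norm_nonneg m).eq_or_lt with h0 | h0
  · exact h0.symm.le.trans (norm_nonneg _)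
  · rw [pow_two] at h3
    exact le_of_mul_le_mul_right h3 h0

theorem isometry_bidualMap_of_norm_eq (h : ∀ m : E, ‖bidualMap A m‖ = ‖m‖) :
    Isometry (bidualMap A : E → moduleDual A (moduleDual A E)) :=
  Isometry.of_dist_eq fun m n => by
    rw [dist_eq_norm, dist_eq_norm, bidualMap_sub, h]

end Dual

/-! ### Coordinates of bounded module functionals on `l₂(C(X))` -/

section Functionals

namespace L2

/-- The standard basis vector `eᵢ` of `l₂(A)`. -/
def single (A : Type*) [CommCStarAlgebra A] (i : ℕ) : L2 A :=
  ⟨Pi.single i 1, summable_of_ne_finset_zero (s := {i}) fun j hj => by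
    rw [Pi.single_eq_of_ne (by simpa using hj), mul_zero]⟩

variable {A : Type*} [CommCStarAlgebra A]

theorem norm_sq (m : L2 A) : ‖m‖ ^ 2 = ‖∑' i, star (m.1 i) * m.1 i‖ :=
  Real.sq_sqrt (norm_nonneg _)

theorem sum_smul_single_apply (w : ℕ → A) (s : Finset ℕ) (j : ℕ) :
    (∑ i ∈ s, w i • single A i : L2 A).1 j = if j ∈ s then w j else 0 := by
  have h : (∑ i ∈ s, w i • single A i : L2 A).1 = ∑ i ∈ s, w i • (Pi.single i 1 : ℕ → A) :=
    map_sum (l2Submodule A).subtype (fun i => w i • (single A i : l2Submodule A)) s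
  rw [h, Finset.sum_apply]
  simp [Pi.single_apply]

theorem norm_sq_sum_smul_single (w : ℕ → A) (s : Finset ℕ) :
    ‖(∑ i ∈ s, w i • single A i : L2 A)‖ ^ 2 = ‖∑ i ∈ s, star (w i) * w i‖ := by
  rw [norm_sq, tsum_eq_sum (s := s)]
  · refine congrArg norm (Finset.sum_congr rfl fun i hi => ?_)
    rw [sum_smul_single_apply, if_pos hi]
  · intro i hi
    rw [sum_smul_single_apply, if_neg hi, mul_zero]

theorem hasSum_smul_single (m : L2 A) : HasSum (fun i => m.1 i • single A i) m := by
  have h := (summable_inner m m).hasSum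
  unfold HasSum at h ⊢
  rw [tendsto_iff_norm_sub_tendsto_zero] at h ⊢
  have key : ∀ s : Finset ℕ, ‖∑ i ∈ s, m.1 i • single A i - m‖ =
      √‖∑ i ∈ s, star (m.1 i) * m.1 i - ∑' i, star (m.1 i) * m.1 i‖ := by
    intro s
    rw [norm_sub_rev, ← Real.sqrt_sq (norm_nonneg (m - _)), norm_sq,
      ← (summable_inner m m).sum_add_tsum_compl (s := s), sub_add_cancel_left, norm_neg,
      tsum_subtype (↑s : Set ℕ)ᶜ (fun i => star (m.1 i) * m.1 i)]
    refine congrArg (fun z : A => √‖z‖) (tsum_congr fun i => ?_)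
    have hi : (m - ∑ i ∈ s, m.1 i • single A i).1 i = m.1 i - if i ∈ s then m.1 i else 0 := by
      rw [← sum_smul_single_apply m.1 s i]
      rfl
    rw [hi]
    by_cases his : i ∈ s <;> simp [his]
  simp only [key]
  simpa using h.sqrt

theorem hasSum_functional_apply (f : moduleDual A (L2 A)) (m : L2 A) :
    HasSum (fun i => m.1 i * f.1 (single A i)) (f.1 m) := by
  have h := (hasSum_smul_single m).mapL f.1
  have hs : (fun i => m.1 i * f.1 (single A i)) = fun i => f.1 (m.1 i • single A i) :=
    funext fun i => (f.2 _ _).symm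
  rw [hs]
  exact h

theorem functional_ext {f g : moduleDual A (L2 A)}
    (h : ∀ i, f.1 (single A i) = g.1 (single A i)) : f = g := by
  refine Subtype.ext (ContinuousLinearMap.ext fun m => ?_)
  refine (hasSum_functional_apply f m).unique ?_
  simpa only [h] using hasSum_functional_apply g m

variable {X : Type*} [TopologicalSpace X]

theorem sum_star_mul_self_apply (w : ℕ → C(X, ℂ)) (s : Finset ℕ) (x : X) :
    (∑ i ∈ s, star (w i) * w i) x = ((∑ i ∈ s, ‖w i x‖ ^ 2 : ℝ) : ℂ) := by
  rw [ContinuousMap.sum_apply, Complex.ofReal_sum]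
  refine Finset.sum_congr rfl fun i _ => ?_
  rw [ContinuousMap.mul_apply, ContinuousMap.star_apply, Complex.star_def, Complex.conj_mul',
    Complex.ofReal_pow]

theorem norm_sum_star_mul_self_apply (w : ℕ → C(X, ℂ)) (s : Finset ℕ) (x : X) :
    ‖(∑ i ∈ s, star (w i) * w i) x‖ = ∑ i ∈ s, ‖w i x‖ ^ 2 := by
  rw [sum_star_mul_self_apply, Complex.norm_real, Real.norm_of_nonneg]
  positivity

variable [CompactSpace X]

theorem sum_norm_sq_le (m : L2 C(X, ℂ)) (s : Finset ℕ) (x : X) :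
    ∑ i ∈ s, ‖m.1 i x‖ ^ 2 ≤ ‖m‖ ^ 2 := by
  have h : HasSum (fun i => ‖m.1 i x‖ ^ 2) (‖(∑' i, star (m.1 i) * m.1 i) x‖) := by
    have h1 : HasSum (fun i => (star (m.1 i) * m.1 i) x) ((∑' i, star (m.1 i) * m.1 i) x) :=
      (summable_inner m m).hasSum.mapL (ContinuousMap.evalCLM ℂ x)
    unfold HasSum at h1 ⊢
    refine h1.norm.congr fun t => ?_
    rw [← norm_sum_star_mul_self_apply, ContinuousMap.sum_apply]
  rw [norm_sq]
  exact (sum_le_hasSum s (fun i _ => by positivity) h).trans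
    (ContinuousMap.norm_coe_le_norm _ x)

/-- Cauchy–Schwarz inequality for finite sections. -/
theorem norm_sum_mul_le {w : ℕ → C(X, ℂ)} {B : ℝ} (hB : 0 ≤ B) (s : Finset ℕ)
    (hw : ∀ x, ∑ i ∈ s, ‖w i x‖ ^ 2 ≤ B ^ 2) (m : ℕ → C(X, ℂ)) :
    ‖∑ i ∈ s, m i * w i‖ ≤ B * √‖∑ i ∈ s, star (m i) * m i‖ := by
  rw [ContinuousMap.norm_le _ (by positivity)]
  intro x
  calc ‖(∑ i ∈ s, m i * w i) x‖ ≤ ∑ i ∈ s, ‖w i x‖ * ‖m i x‖ := by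
        rw [ContinuousMap.sum_apply]
        refine (norm_sum_le _ _).trans (Finset.sum_le_sum fun i _ => ?_)
        rw [ContinuousMap.mul_apply, norm_mul, mul_comm]
    _ ≤ √(∑ i ∈ s, ‖w i x‖ ^ 2) * √(∑ i ∈ s, ‖m i x‖ ^ 2) :=
        Real.sum_mul_le_sqrt_mul_sqrt _ _ _
    _ ≤ B * √‖∑ i ∈ s, star (m i) * m i‖ := by
        refine mul_le_mul (Real.sqrt_le_iff.2 ⟨hB, hw x⟩) (Real.sqrt_le_sqrt ?_)
          (Real.sqrt_nonneg _) hB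
        rw [← norm_sum_star_mul_self_apply]
        exact ContinuousMap.norm_coe_le_norm _ x

theorem summable_mul_of_sum_norm_sq_le {w : ℕ → C(X, ℂ)} {B : ℝ} (hB : 0 ≤ B)
    (hw : ∀ (s : Finset ℕ) (x : X), ∑ i ∈ s, ‖w i x‖ ^ 2 ≤ B ^ 2) (m : L2 C(X, ℂ)) :
    Summable fun i => m.1 i * w i := by
  have hm := summable_inner m m
  rw [summable_iff_vanishing_norm] at hm ⊢
  intro ε hε
  obtain ⟨s, hs⟩ := hm ((ε / (B + 1)) ^ 2) (by positivity)
  refine ⟨s, fun t ht => (norm_sum_mul_le hB t (hw t) m.1).trans_lt ?_⟩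
  have h1 : √‖∑ i ∈ t, star (m.1 i) * m.1 i‖ < ε / (B + 1) :=
    (Real.sqrt_lt' (by positivity)).2 (hs t ht)
  rw [lt_div_iff₀ (by positivity)] at h1
  nlinarith [Real.sqrt_nonneg ‖∑ i ∈ t, star (m.1 i) * m.1 i‖]

theorem norm_tsum_mul_le {w : ℕ → C(X, ℂ)} {B : ℝ} (hB : 0 ≤ B)
    (hw : ∀ (s : Finset ℕ) (x : X), ∑ i ∈ s, ‖w i x‖ ^ 2 ≤ B ^ 2) (m : L2 C(X, ℂ)) :
    ‖∑' i, m.1 i * w i‖ ≤ B * ‖m‖ := by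
  refine le_of_tendsto (summable_mul_of_sum_norm_sq_le hB hw m).hasSum.norm
    (Filter.Eventually.of_forall fun s => (norm_sum_mul_le hB s (hw s) m.1).trans ?_)
  refine mul_le_mul_of_nonneg_left (Real.sqrt_le_iff.2 ⟨norm_nonneg _, ?_⟩) hB
  rw [ContinuousMap.norm_le _ (by positivity)]
  intro x
  rw [norm_sum_star_mul_self_apply]
  exact sum_norm_sq_le m s x

/-- The functional `m ↦ ∑ mᵢ wᵢ` on `l₂(C(X))` given by a sequence `w` for which the finite sums
`∑ |wᵢ|²` are uniformly bounded by `B²`. Convergence of `∑ |wᵢ|²` in norm is not required. -/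
def ofCoeff (w : ℕ → C(X, ℂ)) (B : ℝ) (hB : 0 ≤ B)
    (hw : ∀ (s : Finset ℕ) (x : X), ∑ i ∈ s, ‖w i x‖ ^ 2 ≤ B ^ 2) :
    moduleDual C(X, ℂ) (L2 C(X, ℂ)) :=
  ⟨LinearMap.mkContinuous
    { toFun := fun m => ∑' i, m.1 i * w i
      map_add' := fun m n => by
        rw [← (summable_mul_of_sum_norm_sq_le hB hw m).tsum_add
          (summable_mul_of_sum_norm_sq_le hB hw n)]
        exact tsum_congr fun i => add_mul _ _ _
      map_smul' := fun z m => by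
        rw [RingHom.id_apply, ← (summable_mul_of_sum_norm_sq_le hB hw m).tsum_const_smul]
        exact tsum_congr fun i => smul_mul_assoc z (m.1 i) (w i) } B
    (norm_tsum_mul_le hB hw),
  fun a m => by
    change ∑' i, a * m.1 i * w i = a * ∑' i, m.1 i * w i
    rw [← (summable_mul_of_sum_norm_sq_le hB hw m).tsum_mul_left]
    exact tsum_congr fun i => mul_assoc _ _ _⟩

variable {w : ℕ → C(X, ℂ)} {B : ℝ} (hB : 0 ≤ B)
    (hw : ∀ (s : Finset ℕ) (x : X), ∑ i ∈ s, ‖w i x‖ ^ 2 ≤ B ^ 2)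

theorem ofCoeff_apply (m : L2 C(X, ℂ)) : (ofCoeff w B hB hw).1 m = ∑' i, m.1 i * w i := rfl

@[simp]
theorem ofCoeff_single (i : ℕ) : (ofCoeff w B hB hw).1 (single _ i) = w i := by
  rw [ofCoeff_apply, tsum_eq_single i]
  · simp [single]
  · intro j hj
    simp [single, hj]

theorem norm_ofCoeff_le : ‖ofCoeff w B hB hw‖ ≤ B :=
  moduleDual.norm_le_of_bound _ hB
    (norm_tsum_mul_le hB hw)

/-- A functional whose coordinates satisfy `∑ |fᵢ|² ≤ B²` has norm at most `B`. -/
theorem norm_functional_le (f : moduleDual C(X, ℂ) (L2 C(X, ℂ))) {B : ℝ} (hB : 0 ≤ B)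
    (hf : ∀ (s : Finset ℕ) (x : X), ∑ i ∈ s, ‖f.1 (single _ i) x‖ ^ 2 ≤ B ^ 2) : ‖f‖ ≤ B := by
  have h : f = ofCoeff (fun i => f.1 (single _ i)) B hB hf :=
    functional_ext fun i => (ofCoeff_single hB hf i).symm
  rw [h]
  exact norm_ofCoeff_le hB hf

/-- Used with `t = ‖∑ |gᵢ|²‖`, the size of the value of a functional of norm `N` at an element of
norm at most `√t`. -/
theorem le_sq_of_le_mul_sqrt {t N : ℝ} (ht : 0 ≤ t) (h : t ≤ N * √t) : t ≤ N ^ 2 := by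
  rcases ht.eq_or_lt with rfl | ht
  · positivity
  · have hs : 0 < √t := Real.sqrt_pos.2 ht
    have h1 : √t ≤ N := by
      nlinarith [Real.mul_self_sqrt ht.le]
    rw [← Real.sq_sqrt ht.le]
    exact pow_le_pow_left₀ hs.le h1 2

/-- Finite sums of the `|fᵢ|²` are bounded by `‖f‖²`: evaluate `f` at `∑ fᵢ* eᵢ`. -/
theorem sum_norm_sq_functional_le (f : moduleDual C(X, ℂ) (L2 C(X, ℂ))) (s : Finset ℕ) (x : X) :
    ∑ i ∈ s, ‖f.1 (single _ i) x‖ ^ 2 ≤ ‖f‖ ^ 2 := by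
  set g : ℕ → C(X, ℂ) := fun i => f.1 (single _ i) with hg
  rw [← norm_sum_star_mul_self_apply g]
  refine (ContinuousMap.norm_coe_le_norm _ x).trans (le_sq_of_le_mul_sqrt (norm_nonneg _) ?_)
  set m : L2 C(X, ℂ) := ∑ i ∈ s, star (g i) • single _ i with hm
  have hfm : f.1 m = ∑ i ∈ s, star (g i) * g i := by
    rw [hm, map_sum]
    exact Finset.sum_congr rfl fun i _ => f.2 _ _
  have hnm : ‖m‖ = √‖∑ i ∈ s, star (g i) * g i‖ := by
    rw [← Real.sqrt_sq (norm_nonneg m), norm_sq_sum_smul_single]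
    simp only [star_star, mul_comm]
  rw [← hnm, ← hfm]
  exact moduleDual.norm_apply_le f m

/-! ### Coordinates of elements of the bidual -/

/-- The coordinate functional `m ↦ mᵢ`, that is, `⟨eᵢ, ·⟩`. -/
def coord (X : Type*) [TopologicalSpace X] [CompactSpace X] (i : ℕ) :
    moduleDual C(X, ℂ) (L2 C(X, ℂ)) :=
  ofCoeff (Pi.single i 1) 1 zero_le_one fun s x => by
    calc ∑ j ∈ s, ‖(Pi.single i 1 : ℕ → C(X, ℂ)) j x‖ ^ 2 = ∑ j ∈ s, if j = i then 1 else 0 :=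
          Finset.sum_congr rfl fun j _ => by
            by_cases h : j = i
            · subst h
              simp
            · simp [h]
      _ ≤ 1 ^ 2 := by
          rw [Finset.sum_ite_eq']
          split_ifs <;> simp

theorem coord_single (i j : ℕ) :
    (coord X i).1 (single _ j) = (Pi.single i 1 : ℕ → C(X, ℂ)) j :=
  ofCoeff_single _ _ j

theorem coord_apply (i : ℕ) (m : L2 C(X, ℂ)) : (coord X i).1 m = m.1 i := by
  change ∑' j, m.1 j * (Pi.single i 1 : ℕ → C(X, ℂ)) j = m.1 i
  rw [tsum_eq_single i]
  · simp
  · intro j hj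
    simp [hj]

theorem sum_smul_coord_single (w : ℕ → C(X, ℂ)) (s : Finset ℕ) (j : ℕ) :
    (∑ i ∈ s, w i • coord X i).1 (single _ j) = if j ∈ s then w j else 0 := by
  have h : (∑ i ∈ s, w i • coord X i).1 (single _ j) =
      ∑ i ∈ s, w i * (coord X i).1 (single _ j) := by
    rw [AddSubmonoidClass.coe_finsetSum, sum_apply]
    rfl
  rw [h]
  simp [coord_single, Pi.single_apply]

theorem bidual_sum_smul_coord (F : moduleDual C(X, ℂ) (moduleDual C(X, ℂ) (L2 C(X, ℂ))))
    (w : ℕ → C(X, ℂ)) (s : Finset ℕ) :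
    F.1 (∑ i ∈ s, w i • coord X i) = ∑ i ∈ s, w i * F.1 (coord X i) := by
  rw [map_sum]
  exact Finset.sum_congr rfl fun i _ => F.2 _ _

/-- Finite sums of the `|F(eᵢ*)|²` are bounded by `‖F‖²`, where `eᵢ*` is the `i`-th coordinate
functional. -/
theorem sum_norm_sq_bidual_le (F : moduleDual C(X, ℂ) (moduleDual C(X, ℂ) (L2 C(X, ℂ))))
    (s : Finset ℕ) (x : X) : ∑ i ∈ s, ‖F.1 (coord X i) x‖ ^ 2 ≤ ‖F‖ ^ 2 := by
  set g : ℕ → C(X, ℂ) := fun i => F.1 (coord X i) with hg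
  rw [← norm_sum_star_mul_self_apply g]
  refine (ContinuousMap.norm_coe_le_norm _ x).trans (le_sq_of_le_mul_sqrt (norm_nonneg _) ?_)
  have hF := bidual_sum_smul_coord F (fun i => star (g i)) s
  rw [← hF]
  refine (moduleDual.norm_apply_le F _).trans (mul_le_mul_of_nonneg_left ?_ (norm_nonneg F))
  rw [hF]
  refine norm_functional_le _ (Real.sqrt_nonneg _) fun t y => ?_
  rw [Real.sq_sqrt (norm_nonneg _)]
  calc ∑ i ∈ t, ‖(∑ i ∈ s, star (g i) • coord X i).1 (single _ i) y‖ ^ 2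
      = ∑ i ∈ t, if i ∈ s then ‖g i y‖ ^ 2 else 0 := by
        refine Finset.sum_congr rfl fun i _ => ?_
        rw [sum_smul_coord_single]
        split_ifs <;> simp
    _ ≤ ∑ i ∈ s, ‖g i y‖ ^ 2 := by
        rw [← Finset.sum_filter]
        exact Finset.sum_le_sum_of_subset_of_nonneg
          (fun i hi => (Finset.mem_filter.1 hi).2) fun _ _ _ => by positivity
    _ ≤ _ := by
        rw [← norm_sum_star_mul_self_apply g]
        exact ContinuousMap.norm_coe_le_norm _ y

/-! ### The canonical map into the bidual is isometric -/

theorem norm_bidualMap (m : L2 C(X, ℂ)) : ‖bidualMap C(X, ℂ) m‖ = ‖m‖ := by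
  -- Evaluation at the functional `⟨m, ·⟩` recovers `‖m‖`.
  have hw : ∀ (s : Finset ℕ) (x : X), ∑ i ∈ s, ‖star (m.1 i) x‖ ^ 2 ≤ ‖m‖ ^ 2 := by
    intro s x
    simpa using sum_norm_sq_le m s x
  refine norm_bidualMap_eq_of_norming (norm_ofCoeff_le (norm_nonneg m) hw) ?_
  rw [ofCoeff_apply, norm_sq]
  simp only [mul_comm (star _)]

theorem isometry_bidualMap :
    Isometry (bidualMap C(X, ℂ) : L2 C(X, ℂ) → moduleDual C(X, ℂ) (moduleDual C(X, ℂ) (L2 C(X, ℂ)))) := by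
  exact isometry_bidualMap_of_norm_eq norm_bidualMap

end L2

end Functionals

end

noncomputable section

/-! ### Elements of the bidual are determined by their coordinates -/

section Bidual

namespace L2

variable {X : Type*} [TopologicalSpace X] [CompactSpace X] [T2Space X]

/-- By the Baire category theorem, the series `∑ |fᵢ|²` of a functional has small tails on
neighbourhoods of the points of a dense set; after multiplication by a bump function, `f` is
there close in norm to a finite combination of coordinate functionals. -/
theorem exists_norm_smul_sub_sum_coord_le (f : moduleDual C(X, ℂ) (L2 C(X, ℂ))) {U : Set X}
    (hU : IsOpen U) (hne : U.Nonempty) {η : ℝ} (hη0 : 0 < η) :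
    ∃ y ∈ U, ∃ (φ : C(X, ℂ)) (v : ℕ → C(X, ℂ)) (s : Finset ℕ), φ y = 1 ∧
      ‖φ • f - ∑ i ∈ s, v i • coord X i‖ ≤ η := by
  set w : ℕ → C(X, ℂ) := fun i => f.1 (single _ i) with hw
  set E : ℕ → Set X := fun n =>
    {x | ∀ s : Finset ℕ, (∀ i ∈ s, n ≤ i) → ∑ i ∈ s, ‖w i x‖ ^ 2 ≤ η ^ 2} with hE
  have hEc : ∀ n, IsClosed (E n) := by
    intro n
    simp only [hE, Set.ofPred_forall]
    refine isClosed_iInter fun s => isClosed_iInter fun _ => ?_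
    exact isClosed_le (continuous_finsetSum _ fun i _ => ((w i).continuous.norm.pow 2))
      continuous_const
  have hEu : ⋃ n, E n = Set.univ := by
    refine Set.eq_univ_of_forall fun x => ?_
    have hs : Summable fun i => ‖w i x‖ ^ 2 :=
      summable_of_sum_le (fun i => by positivity) fun s => sum_norm_sq_functional_le f s x
    obtain ⟨s, hs⟩ := summable_iff_vanishing_norm.1 hs (η ^ 2) (by positivity)
    obtain ⟨n, hn⟩ := s.exists_nat_subset_range
    refine Set.mem_iUnion.2 ⟨n, fun t ht => ?_⟩
    refine (le_abs_self _).trans (hs t ?_).le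
    rw [Finset.disjoint_left]
    intro i hi his
    exact absurd (Finset.mem_range.1 (hn his)) (not_lt.2 (ht i hi))
  obtain ⟨y, hyU, hyE⟩ := (dense_iUnion_interior_of_closed hEc hEu).inter_open_nonempty U hU hne
  obtain ⟨n, hn⟩ := Set.mem_iUnion.1 hyE
  obtain ⟨φ, hφy, hφ0, hφ1⟩ := exists_bump isOpen_interior hn
  set f' : moduleDual C(X, ℂ) (L2 C(X, ℂ)) :=
    φ • f - ∑ i ∈ Finset.range n, (φ * w i) • coord X i with hf'
  have hcoeff : ∀ i, f'.1 (single _ i) = if n ≤ i then φ * w i else 0 := by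
    intro i
    have h : f'.1 (single _ i) = φ * w i -
        (∑ i ∈ Finset.range n, (φ * w i) • coord X i).1 (single _ i) := rfl
    rw [h, sum_smul_coord_single]
    by_cases hi : n ≤ i
    · simp [hi]
    · simp [hi, not_le.1 hi]
  have hnorm : ‖f'‖ ≤ η := by
    refine norm_functional_le f' hη0.le fun s x => ?_
    simp only [hcoeff]
    by_cases hx : x ∈ interior (E n)
    · calc ∑ i ∈ s, ‖(if n ≤ i then φ * w i else 0 : C(X, ℂ)) x‖ ^ 2
          ≤ ∑ i ∈ s, if n ≤ i then ‖w i x‖ ^ 2 else 0 := by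
            refine Finset.sum_le_sum fun i _ => ?_
            split_ifs
            · rw [ContinuousMap.mul_apply, norm_mul]
              exact pow_le_pow_left₀ (by positivity)
                (mul_le_of_le_one_left (norm_nonneg _) (hφ1 x)) 2
            · simp
        _ ≤ η ^ 2 := by
            rw [← Finset.sum_filter]
            exact interior_subset hx _ fun i hi => (Finset.mem_filter.1 hi).2
    · rw [Finset.sum_eq_zero]
      · positivity
      · intro i _
        split_ifs <;> simp [hφ0 x hx]
  exact ⟨y, hyU, φ, fun i => φ * w i, Finset.range n, hφy, hnorm⟩

theorem bidual_smul_sub_sum_coord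
    (F : moduleDual C(X, ℂ) (moduleDual C(X, ℂ) (L2 C(X, ℂ))))
    (f : moduleDual C(X, ℂ) (L2 C(X, ℂ))) (a : C(X, ℂ)) (v : ℕ → C(X, ℂ)) (s : Finset ℕ) :
    F.1 (a • f - ∑ i ∈ s, v i • coord X i) = a * F.1 f - ∑ i ∈ s, v i * F.1 (coord X i) := by
  rw [map_sub, bidual_sum_smul_coord, F.2]

theorem bidual_mul_apply_eq
    (F : moduleDual C(X, ℂ) (moduleDual C(X, ℂ) (L2 C(X, ℂ))))
    {f : moduleDual C(X, ℂ) (L2 C(X, ℂ))} {a : C(X, ℂ)} {v : ℕ → C(X, ℂ)} {s : Finset ℕ}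
    (h : a • f = ∑ i ∈ s, v i • coord X i) : a * F.1 f = ∑ i ∈ s, v i * F.1 (coord X i) := by
  rw [← bidual_sum_smul_coord, ← h, F.2]

/-- An element of the bidual that vanishes on all coordinate functionals is zero, although these
do not in general span a dense submodule of the dual. -/
theorem bidual_apply_eq_zero_of_coord
    (F : moduleDual C(X, ℂ) (moduleDual C(X, ℂ) (L2 C(X, ℂ))))
    (hF : ∀ i, F.1 (coord X i) = 0) (f : moduleDual C(X, ℂ) (L2 C(X, ℂ))) : F.1 f = 0 := by
  by_contra hne
  obtain ⟨x₀, hx₀⟩ : ∃ x, F.1 f x ≠ 0 := by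
    by_contra h
    push Not at h
    exact hne (ContinuousMap.ext h)
  have hδ : 0 < ‖F.1 f x₀‖ := norm_pos_iff.2 hx₀
  obtain ⟨N, hN0, hN⟩ : ∃ N : ℝ, 0 ≤ N ∧ ∀ f', ‖F.1 f'‖ ≤ N * ‖f'‖ :=
    ⟨‖F‖, norm_nonneg F, moduleDual.norm_apply_le F⟩
  generalize hG : F.1 f = G at hx₀ hδ
  obtain ⟨δ, hδ0, hδx⟩ := exists_between hδ
  obtain ⟨y, hyU, φ, v, s, hφy, hnorm⟩ := exists_norm_smul_sub_sum_coord_le f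
    (isOpen_lt continuous_const G.continuous.norm) ⟨x₀, hδx⟩
    (η := δ / (N + 1)) (by positivity)
  have hFf' := bidual_smul_sub_sum_coord F f φ v s
  simp only [hF, mul_zero, Finset.sum_const_zero, sub_zero, hG] at hFf'
  have h1 : ‖G y‖ ≤ N * (δ / (N + 1)) := by
    have h2 := (hN _).trans (mul_le_mul_of_nonneg_left hnorm hN0)
    rw [hFf'] at h2
    refine le_trans ?_ ((ContinuousMap.norm_coe_le_norm _ y).trans h2)
    rw [ContinuousMap.mul_apply, hφy, one_mul]
  have h2 : N * (δ / (N + 1)) ≤ δ := by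
    rw [mul_div_assoc', div_le_iff₀ (by positivity)]
    nlinarith
  exact absurd (h1.trans h2) (not_le.2 hyU)

/-! ### Coordinates of elements of the bidual are square-summable in norm -/

/-- Blocks of a bounded sequence `g` of coordinates are cut off to disjoint open sets and combined
with bounded scalar weights `d` into a single functional on `l₂(C(X))`. Multiplication by the `k`-th
cut-off function leaves only the `k`-th block. -/
theorem exists_functional_of_blocks {g : ℕ → C(X, ℂ)} {N : ℝ} (hN : 0 ≤ N)
    (hgN : ∀ (s : Finset ℕ) (x : X), ∑ i ∈ s, ‖g i x‖ ^ 2 ≤ N ^ 2)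
    {t : ℕ → Finset ℕ} (ht : Pairwise (Function.onFun Disjoint t))
    {φ : ℕ → C(X, ℂ)} (hφ1 : ∀ k x, ‖φ k x‖ ≤ 1) (hφφ : ∀ j k, j ≠ k → φ k * φ j = 0)
    {d : ℕ → ℂ} {B : ℝ} (hB : 0 ≤ B) (hdB : ∀ k, ‖d k‖ ≤ B) :
    ∃ f : moduleDual C(X, ℂ) (L2 C(X, ℂ)), ∀ k,
      φ k • f = ∑ i ∈ t k, (d k • (φ k * φ k * star (g i))) • coord X i := by
  -- `κ i` is the index of the block containing `i`, if there is one.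
  obtain ⟨κ, hκ⟩ : ∃ κ : ℕ → ℕ, ∀ k, ∀ i ∈ t k, κ i = k := by
    classical
    refine ⟨fun i => if hi : ∃ k, i ∈ t k then hi.choose else 0, fun k i hi => ?_⟩
    have hex : ∃ k, i ∈ t k := ⟨k, hi⟩
    dsimp only
    rw [dif_pos hex]
    by_contra hne
    exact Finset.disjoint_left.1 (ht hne) hex.choose_spec hi
  set w : ℕ → C(X, ℂ) := fun i =>
    if i ∈ t (κ i) then d (κ i) • (φ (κ i) * star (g i)) else 0 with hw
  have hwg : ∀ i x, ‖w i x‖ ≤ B * ‖g i x‖ := by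
    intro i x
    simp only [hw]
    split_ifs
    · rw [ContinuousMap.smul_apply, ContinuousMap.mul_apply, norm_smul, norm_mul,
        ContinuousMap.star_apply, norm_star]
      exact mul_le_mul (hdB _) (mul_le_of_le_one_left (norm_nonneg _) (hφ1 _ x))
        (by positivity) (by positivity)
    · rw [ContinuousMap.zero_apply, norm_zero]
      positivity
  have hwB : ∀ (s : Finset ℕ) (x : X), ∑ i ∈ s, ‖w i x‖ ^ 2 ≤ (B * N) ^ 2 := by
    intro s x
    calc ∑ i ∈ s, ‖w i x‖ ^ 2 ≤ ∑ i ∈ s, B ^ 2 * ‖g i x‖ ^ 2 := by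
          refine Finset.sum_le_sum fun i _ => ?_
          rw [← mul_pow]
          exact pow_le_pow_left₀ (norm_nonneg _) (hwg i x) 2
      _ ≤ (B * N) ^ 2 := by
          rw [← Finset.mul_sum, mul_pow]
          exact mul_le_mul_of_nonneg_left (hgN s x) (by positivity)
  refine ⟨ofCoeff w _ (by positivity) hwB, fun k => functional_ext fun i => ?_⟩
  have h1 : ∀ f : moduleDual C(X, ℂ) (L2 C(X, ℂ)),
    (φ k • f).1 (single _ i) = φ k * f.1 (single _ i) := fun _ => rfl
  rw [h1, sum_smul_coord_single, ofCoeff_single]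
  simp only [hw]
  by_cases hi : i ∈ t k
  · rw [hκ k i hi, if_pos hi, if_pos hi, mul_smul_comm, mul_assoc]
  · rw [if_neg hi]
    split_ifs with hi'
    · have hne : κ i ≠ k := fun h => hi (h ▸ hi')
      rw [mul_smul_comm, ← mul_assoc, hφφ _ _ hne, zero_mul, smul_zero]
    · rw [mul_zero]

/-- If disjoint blocks of coordinates of `F` are bounded below at points that lie in disjoint open
sets, then every bounded scalar function on these points extends continuously to `X`: the extension
is the image under `F` of a functional with suitable coordinates. -/
theorem exists_interpolation_of_bidual
    (F : moduleDual C(X, ℂ) (moduleDual C(X, ℂ) (L2 C(X, ℂ))))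
    {t : ℕ → Finset ℕ} (ht : Pairwise (Function.onFun Disjoint t))
    {U : ℕ → Set X} (hUo : ∀ k, IsOpen (U k)) (hU : Pairwise (Function.onFun Disjoint U))
    {y : ℕ → X} (hy : ∀ k, y k ∈ U k) {ε : ℝ} (hε : 0 < ε)
    (hty : ∀ k, ε ≤ ∑ i ∈ t k, ‖F.1 (coord X i) (y k)‖ ^ 2)
    (c : ℕ → ℂ) (B : ℝ) (hc : ∀ k, ‖c k‖ ≤ B) : ∃ G : C(X, ℂ), ∀ k, G (y k) = c k := by
  choose φ hφy hφ0 hφ1 using fun k => exists_bump (hUo k) (hy k)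
  have hφφ : ∀ j k, j ≠ k → φ k * φ j = 0 := by
    intro j k hjk
    ext x
    rw [ContinuousMap.mul_apply]
    by_cases hx : x ∈ U k
    · rw [hφ0 j x fun h => Set.disjoint_left.1 (hU hjk) h hx, mul_zero]
      rfl
    · rw [hφ0 k x hx, zero_mul]
      rfl
  have hB : 0 ≤ B := (norm_nonneg _).trans (hc 0)
  obtain ⟨N, hN, hgN⟩ : ∃ N : ℝ, 0 ≤ N ∧
      ∀ (s : Finset ℕ) (x : X), ∑ i ∈ s, ‖F.1 (coord X i) x‖ ^ 2 ≤ N ^ 2 :=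
    ⟨‖F‖, norm_nonneg F, sum_norm_sq_bidual_le F⟩
  obtain ⟨g, hg⟩ : ∃ g : ℕ → C(X, ℂ), ∀ i, F.1 (coord X i) = g i := ⟨_, fun _ => rfl⟩
  simp only [hg] at hgN hty
  set h : ℕ → ℝ := fun k => ∑ i ∈ t k, ‖g i (y k)‖ ^ 2 with hh
  have hh0 : ∀ k, 0 < h k := fun k => hε.trans_le (hty k)
  -- The image under `F` of the combination with weights `d` has the value `d k * h k` at `y k`.
  set d : ℕ → ℂ := fun k => c k / h k with hd
  have hdB : ∀ k, ‖d k‖ ≤ B / ε := by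
    intro k
    rw [hd, norm_div, Complex.norm_real, Real.norm_of_nonneg (hh0 k).le]
    exact div_le_div₀ hB (hc k) hε (hty k)
  obtain ⟨f, hf⟩ := exists_functional_of_blocks hN hgN ht hφ1 hφφ (by positivity) hdB
  refine ⟨F.1 f, fun k => ?_⟩
  have h2 := bidual_mul_apply_eq F (hf k)
  simp only [hg] at h2
  replace h2 := congrArg (fun z : C(X, ℂ) => z (y k)) h2
  simp only [ContinuousMap.mul_apply, hφy, one_mul, ContinuousMap.sum_apply,
    ContinuousMap.smul_apply, ContinuousMap.star_apply, smul_eq_mul] at h2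
  rw [h2]
  calc ∑ i ∈ t k, d k * star (g i (y k)) * g i (y k)
      = d k * ((h k : ℝ) : ℂ) := by
        rw [hh, Complex.ofReal_sum, Finset.mul_sum]
        refine Finset.sum_congr rfl fun i _ => ?_
        rw [mul_assoc, Complex.star_def, Complex.conj_mul', Complex.ofReal_pow]
    _ = c k := div_mul_cancel₀ _ (Complex.ofReal_ne_zero.2 (hh0 k).ne')

/-- A gliding hump produces disjoint blocks of coordinates that are bounded below at points `x k`.
Each point occurs only finitely often among these, so that a subsequence can be separated by
disjoint open sets. -/
theorem summable_bidual_coord (hX : ¬ ∃ f : StoneCech ℕ → X, Topology.IsClosedEmbedding f)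
    (F : moduleDual C(X, ℂ) (moduleDual C(X, ℂ) (L2 C(X, ℂ)))) :
    Summable fun i => star (F.1 (coord X i)) * F.1 (coord X i) := by
  set g : ℕ → C(X, ℂ) := fun i => F.1 (coord X i) with hg
  by_contra hns
  rw [summable_iff_vanishing_norm] at hns
  push Not at hns
  obtain ⟨ε, hε, hns⟩ := hns
  have hns' : ∀ s : Finset ℕ, ∃ (t : Finset ℕ) (x : X), Disjoint t s ∧
      ε / 2 ≤ ∑ i ∈ t, ‖g i x‖ ^ 2 := by
    intro s
    obtain ⟨t, hts, ht⟩ := hns s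
    by_contra hcon
    push Not at hcon
    have h1 : ‖∑ i ∈ t, star (g i) * g i‖ ≤ ε / 2 := by
      rw [ContinuousMap.norm_le _ (by positivity)]
      intro x
      rw [norm_sum_star_mul_self_apply]
      exact (hcon t x hts).le
    linarith
  obtain ⟨q, hq, hqd⟩ := exists_seq_of_forall_finset_exists'
    (fun q : Finset ℕ × X => ε / 2 ≤ ∑ i ∈ q.1, ‖g i q.2‖ ^ 2) (fun p q => Disjoint p.1 q.1)
    (by
      intro S _
      obtain ⟨t, x, htx, h⟩ := hns' (S.biUnion Prod.fst)
      exact ⟨(t, x), h, fun p hp => (htx.mono_right (Finset.subset_biUnion_of_mem _ hp)).symm⟩)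
  have hfin : ∀ p, {k | (q k).2 = p}.Finite := by
    intro p
    by_contra hinf
    obtain ⟨N, hN⟩ := exists_nat_gt (‖F‖ ^ 2 / (ε / 2))
    obtain ⟨K, hK, hcard⟩ := Set.Infinite.exists_subset_card_eq hinf N
    rw [div_lt_iff₀ (by positivity)] at hN
    have h1 : (N : ℝ) * (ε / 2) ≤ ∑ k ∈ K, ∑ i ∈ (q k).1, ‖g i p‖ ^ 2 := by
      rw [← hcard, ← nsmul_eq_mul]
      refine Finset.card_nsmul_le_sum _ _ _ fun k hk => ?_
      have hkp : (q k).2 = p := hK hk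
      rw [← hkp]
      exact hq k
    rw [← Finset.sum_biUnion fun a _ b _ hab => hqd hab] at h1
    linarith [sum_norm_sq_bidual_le F (K.biUnion fun k => (q k).1) p]
  obtain ⟨σ, U, hσ, hUo, hU, hσU⟩ := exists_subseq_mem_pairwise_disjoint_isOpen hfin
  exact hX (exists_isClosedEmbedding_stoneCech_of_interpolation (fun k => (q (σ k)).2)
    (exists_interpolation_of_bidual F (t := fun k => (q (σ k)).1)
      (fun a b hab => hqd (hσ.ne hab)) hUo hU hσU (half_pos hε) fun k => hq (σ k)))

end L2

end Bidual

end

theorem mainTheorem3 {X : Type*} [TopologicalSpace X] [CompactSpace X] [T2Space X]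
    (hX : ¬ ∃ f : StoneCech ℕ → X, Topology.IsClosedEmbedding f) :
    IsCStarReflexive C(X, ℂ) (L2 C(X, ℂ)) := by
  refine ⟨L2.isometry_bidualMap, fun F => ?_⟩
  set m : L2 C(X, ℂ) := ⟨fun i => F.1 (L2.coord X i), L2.summable_bidual_coord hX F⟩ with hm
  refine ⟨m, Subtype.ext (ContinuousLinearMap.ext fun f => ?_)⟩
  have h := L2.bidual_apply_eq_zero_of_coord (bidualMap C(X, ℂ) m - F) (fun i => ?_) f
  · exact sub_eq_zero.1 h
  · change (L2.coord X i).1 m - F.1 (L2.coord X i) = 0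
    rw [L2.coord_apply, sub_self]
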